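/- A polynomial with integer coefficients (in one or two variables) is said to be of magnitude $(n,\tau)$ if its (total) degree is at most $n$ and all its coefficients have absolute value at most $2^{\tau}$. Here degree bounds are natural numbers and the bounds $\Lambda,\tau_1,\tau_2$ below are non-negative reals; $\log$ is the logarithm to base $2$. For a real quantity $S$ and $B\ge 0$, depending on some data, we write $S\in\tilde O(B)$ if there are absolute constants $C\in\mathbb{R}$ and $k\in\mathbb{N}$, independent of all the data, such that $S\le C\cdot B\cdot(\log(2+B))^k$ (an upper bound for $S$ itself, not for $|S|$). Let $R\in\mathbb{Z}[X]$ be of magnitude $(N,\Lambda)$ and let $F\in\mathbb{Z}[X,Y]$ be of magnitude $(n_1,\tau_1)$. Put $V_{\mathbb{C}}(R)=\{z\in\mathbb{C}\mid R(z)=0\}$, suppose that $$V_{\mathbb{C}}(R,F)=\{(z,z')\in\mathbb{C}^2\mid R(z)=F(z,z')=0\}$$ is finite, and let $\mu(z)$ denote the multiplicity of $z$ as a root of $R$. For $A\subseteq V_{\mathbb{C}}(R,F)$ and $z\in\mathbb{C}$ put $A_z=\{z'\in\mathbb{C}\mid (z,z')\in A\}$. Let $G_1,\dots,G_m\in\mathbb{C}[X,Y]$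 be polynomials of total degree at most $n_2$ whose coefficients have absolute value at most $2^{\tau_2}$. (a) Let $A\subseteq V_{\mathbb{C}}(R,F)$ and, for every $(z,z')\in A$, let $i(z,z')\in\{1,\dots,m\}$ be such that $G_{i(z,z')}(z,z')\neq 0$. Then $$\sum_{z\in V_{\mathbb{C}}(R)}\mu(z)\sum_{z'\in A_z}\log|G_{i(z,z')}(z,z')|\in\tilde O\big((\tau_2n_1+\tau_1n_2)N+(\Lambda+N)n_1n_2\big).$$ (b) Suppose moreover that $G_1,\dots,G_m\in\mathbb{Z}[X,Y]$ and that for every $(z,z')\in V_{\mathbb{C}}(R,F)$ there is an $i$ with $G_i(z,z')\neq 0$; let $i(z,z')$ be the smallest such $i$. Then $$\sum_{z\in V_{\mathbb{C}}(R)}\mu(z)\sum_{z'\in V_{\mathbb{C}}(R,F)_z}\big|\log|G_{i(z,z')}(z,z')|\big|\in\tilde O\big((\tau_2n_1+\tau_1n_2)N+(\Lambda+N)n_1n_2\big).$$ -/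

import Mathlib

/-- `f ∈ ℤ[X]` is of magnitude `(n, τ)`: degree at most `n`, and every coefficient of absolute
value at most `2 ^ τ`. -/
def HasMagnitude (f : Polynomial ℤ) (n : ℕ) (τ : ℝ) : Prop :=
  f.natDegree ≤ n ∧ ∀ k : ℕ, |((f.coeff k : ℤ) : ℝ)| ≤ (2 : ℝ) ^ τ

/-- `F ∈ ℤ[X,Y]` is of magnitude `(n, τ)`: total degree at most `n`, and every coefficient of
absolute value at most `2 ^ τ`. -/
def HasMagnitude₂ (F : MvPolynomial (Fin 2) ℤ) (n : ℕ) (τ : ℝ) : Prop :=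
  F.totalDegree ≤ n ∧ ∀ d : Fin 2 →₀ ℕ, |((F.coeff d : ℤ) : ℝ)| ≤ (2 : ℝ) ^ τ

/-- The value `F(z, z')` of an integer bivariate polynomial at a complex point. -/
noncomputable def evalInt₂ (F : MvPolynomial (Fin 2) ℤ) (z z' : ℂ) : ℂ :=
  MvPolynomial.aeval ![z, z'] F

/-- The value `G(z, z')` of a complex bivariate polynomial at a complex point. -/
noncomputable def evalComplex₂ (G : MvPolynomial (Fin 2) ℂ) (z z' : ℂ) : ℂ :=
  MvPolynomial.eval ![z, z'] G

/-- `V_ℂ(R)`: the set of distinct complex roots of `R`. -/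
def rootSetC (R : Polynomial ℤ) : Set ℂ :=
  {z | Polynomial.aeval z R = 0}

/-- `V_ℂ(R, F) = {(z, z') | R(z) = F(z, z') = 0}`. -/
def zeroLocus₂ (R : Polynomial ℤ) (F : MvPolynomial (Fin 2) ℤ) : Set (ℂ × ℂ) :=
  {p | Polynomial.aeval p.1 R = 0 ∧ evalInt₂ F p.1 p.2 = 0}

/-- The fiber `A_z = {z' | (z, z') ∈ A}`. -/
def fiberAt (A : Set (ℂ × ℂ)) (z : ℂ) : Set ℂ :=
  {z' | (z, z') ∈ A}

/-- `μ(z)`: the multiplicity of `z` as a root of `R`. -/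
noncomputable def multC (R : Polynomial ℤ) (z : ℂ) : ℕ :=
  (R.map (Int.castRingHom ℂ)).rootMultiplicity z

/-- The weighted double sum `∑_{z ∈ V_ℂ(R)} μ(z) ∑_{z' ∈ A_z} h(z, z')`.
It is used only for finite `A`, where both sums have finite support. -/
noncomputable def weightedSum (R : Polynomial ℤ) (A : Set (ℂ × ℂ)) (h : ℂ → ℂ → ℝ) : ℝ :=
  ∑ᶠ z ∈ rootSetC R, (multC R z : ℝ) * ∑ᶠ z' ∈ fiberAt A z, h z z'

/-- The soft-O bound `C · B · (log₂ (2 + B)) ^ k`: a quantity is in `Õ(B)` when it is at most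
`softBound C k B` for some constants `C`, `k` that depend on nothing. -/
noncomputable def softBound (C : ℝ) (k : ℕ) (B : ℝ) : ℝ :=
  C * B * (Real.logb 2 (2 + B)) ^ k

/-- `(τ₂ n₁ + τ₁ n₂) N + (Λ + N) n₁ n₂`. -/
noncomputable def bivariateSize (N n₁ n₂ : ℕ) (Λ τ₁ τ₂ : ℝ) : ℝ :=
  (τ₂ * n₁ + τ₁ * n₂) * N + (Λ + N) * n₁ * n₂

/-! Both sums are compared with sums over all pairs (root `z` of `R`, root `z'` of `F(z, ·)`),
counted with multiplicity.

Upper bound: log⁺ of `|G(z, z')|` is at most `τ₂ + 2 log (n₂ + 1) + n₂ (log⁺|z| + log⁺|z'|)`. Mahler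
measure controls the sum of log⁺ over the roots of a polynomial, up to minus the log of its leading
coefficient. For `R` that leading coefficient is a nonzero integer. For the fibers `F(z, ·)` it may
be tiny, but only on average a little: the resultant of `R` and `F` in `X` is a nonzero integer
polynomial in `Y`, and its leading coefficient is a power of that of `R` times the product of the
fiber leading coefficients. Hence the logs of the latter sum to at least `-n₁ Λ`. This gives (a),
where the `G_j` need not be integral.

For (b), `|log x| = 2 log⁺ x - log x`, so a lower bound for the signed sum remains. The pencil `H =
∑ T ^ (m - j) G_j + Y ^ (n₂ + 1)` encodes the choice of the smallest index: `H(z, z')` has leading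
coefficient `G_{i(z, z')}(z, z')` in `T`. Eliminating `Y` from `F` and `H`, then `X` with `R`, gives
a nonzero integer polynomial in `T`, whose leading coefficient has absolute value at least 1. Only
the degree in `X` of the first resultant enters the estimate, so nothing depends on `m`. -/

open Polynomial

/-! ### Specializations and the pencil -/

/-- Evaluation of the variable of `ℤ[T][X]` at a complex number `z`, with values in `ℂ[T]`. -/
noncomputable def specializeAt (z : ℂ) : ℤ[X][X] →+* ℂ[X] :=
  eval₂RingHom (mapRingHom (Int.castRingHom ℂ)) (C z)

/-- The fiber polynomial `F(z, Y) ∈ ℂ[Y]`. -/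
noncomputable def fiberPoly (F : MvPolynomial (Fin 2) ℤ) (z : ℂ) : ℂ[X] :=
  MvPolynomial.aeval ![C z, X] F

/-- `F` as a polynomial in `X` with coefficients in `ℤ[Y]`. -/
noncomputable def asPolyInFst (F : MvPolynomial (Fin 2) ℤ) : ℤ[X][X] :=
  MvPolynomial.aeval ![X, C X] F

/-- `F` as a polynomial in `Y` with coefficients in `ℤ[T][X]`. -/
noncomputable def asPolyInSnd (F : MvPolynomial (Fin 2) ℤ) : ℤ[X][X][X] :=
  MvPolynomial.aeval (![C X, X] : Fin 2 → ℤ[X][X][X]) F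

/-- The pencil `∑ T ^ (m - j) G_j + Y ^ (n + 1)`. -/
noncomputable def pencil {m : ℕ} (G : Fin m → MvPolynomial (Fin 2) ℤ) (n : ℕ) : ℤ[X][X][X] :=
  ∑ j : Fin m, C (C (X ^ (m - (j : ℕ)))) * asPolyInSnd (G j) + X ^ (n + 1)

/-! ### Resultants and integrality of leading coefficients -/

namespace Polynomial

theorem resultant_map_C_eq_prod_eval (f : ℂ[X]) (g : ℂ[X][X]) {n : ℕ} (hg : g.natDegree ≤ n) :
    resultant (f.map C) g f.natDegree n =
      C f.leadingCoeff ^ n * (f.roots.map fun a => g.eval (C a)).prod := by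
  have hs : f.Splits := IsAlgClosed.splits f
  have h := resultant_eq_prod_eval (f.map C) g n hg (hs.map C)
  rw [natDegree_map_eq_of_injective (C_injective), leadingCoeff_map_of_injective C_injective,
    ← roots_map_of_injective_of_card_eq_natDegree C_injective (splits_iff_card_roots.mp hs),
    Multiset.map_map] at h
  exact h

/-- The exponents `m - j` decrease in `j`, so the least index with `a j ≠ 0` gives the top term.
They are all at least 1 because `j < m`, so the constant `b` cannot interfere. -/
theorem leadingCoeff_sum_X_pow_add_C {m : ℕ} (a : Fin m → ℂ) (b : ℂ) {i : Fin m}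
    (hi : IsLeast {j | a j ≠ 0} i) :
    (∑ j : Fin m, X ^ (m - (j : ℕ)) * C (a j) + C b : ℂ[X]).leadingCoeff = a i := by
  have hcoeff : (∑ j : Fin m, X ^ (m - (j : ℕ)) * C (a j) + C b : ℂ[X]).coeff (m - (i : ℕ)) =
      a i := by
    have := i.2
    rw [coeff_add, finsetSum_coeff, Finset.sum_eq_single i, coeff_C_of_ne_zero (by omega)]
    · simp
    · intro j _ hji
      have : (j : ℕ) ≠ i := fun h => hji (Fin.ext h)
      have := j.2
      rw [coeff_mul_C, coeff_X_pow, if_neg (by omega), zero_mul]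
    · simp
  have hdeg : (∑ j : Fin m, X ^ (m - (j : ℕ)) * C (a j) + C b : ℂ[X]).natDegree ≤ m - (i : ℕ) := by
    refine natDegree_add_le_of_degree_le (natDegree_sum_le_of_forall_le _ _ fun j _ => ?_) (by simp)
    by_cases hj : a j = 0
    · simp [hj]
    · have : (i : ℕ) ≤ j := hi.2 hj
      exact (natDegree_mul_C_le _ _).trans ((natDegree_X_pow_le _).trans (by omega))
  have : (∑ j : Fin m, X ^ (m - (j : ℕ)) * C (a j) + C b : ℂ[X]).natDegree = m - (i : ℕ) :=
    le_antisymm hdeg (le_natDegree_of_ne_zero (by rw [hcoeff]; exact hi.1))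
  rw [leadingCoeff, this, hcoeff]

/-- In the Leibniz expansion of the Sylvester determinant, each product takes `m` entries from
columns of `g` and `n` from columns of `f`. -/
theorem natDegree_resultant_le {f g : ℤ[X][X][X]} {m n a b : ℕ}
    (hf : ∀ k, (f.coeff k).natDegree ≤ a) (hg : ∀ k, (g.coeff k).natDegree ≤ b) :
    (resultant f g m n).natDegree ≤ m * b + n * a := by
  rw [resultant, Matrix.det_apply]
  refine natDegree_sum_le_of_forall_le _ _ fun σ _ => (natDegree_smul_le _ _).trans ?_
  refine (natDegree_prod_le _ _).trans ?_
  rw [Fin.sum_univ_add]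
  have h₁ : ∀ i : Fin m, (sylvester f g m n (σ (Fin.castAdd n i)) (Fin.castAdd n i)).natDegree
      ≤ b := by
    intro i
    simp only [sylvester, Matrix.of_apply, Fin.addCases_left]
    split_ifs <;> simp [hg]
  have h₂ : ∀ i : Fin n, (sylvester f g m n (σ (Fin.natAdd m i)) (Fin.natAdd m i)).natDegree
      ≤ a := by
    intro i
    simp only [sylvester, Matrix.of_apply, Fin.addCases_right]
    split_ifs <;> simp [hf]
  refine add_le_add ((Finset.sum_le_sum fun i _ => h₁ i).trans ?_)
    ((Finset.sum_le_sum fun i _ => h₂ i).trans ?_) <;> simp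

/-- If `P(z, T) ≠ 0` at every root `z` of `R`, then the leading coefficients of the `P(z, T)`
multiply, up to a power of the leading coefficient of `R`, to a nonzero integer. -/
theorem one_le_norm_leadingCoeff_pow_mul_prod {R : ℤ[X]} (hR : R ≠ 0) {P : ℤ[X][X]} {D : ℕ}
    (hP : P.natDegree ≤ D)
    (h : ∀ z ∈ (R.map (Int.castRingHom ℂ)).roots, specializeAt z P ≠ 0) :
    1 ≤ |(R.leadingCoeff : ℝ)| ^ D * ((R.map (Int.castRingHom ℂ)).roots.map
      fun z => ‖(specializeAt z P).leadingCoeff‖).prod := by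
  have hinj : Function.Injective (Int.castRingHom ℂ) := Int.cast_injective
  set ψ := mapRingHom (Int.castRingHom ℂ) with hψ
  set f := R.map (Int.castRingHom ℂ) with hf
  set r := resultant (R.map C) P R.natDegree D with hr
  have key : ψ r = C f.leadingCoeff ^ D * (f.roots.map fun z => specializeAt z P).prod := by
    rw [hr, ← resultant_map_map]
    have h1 : (R.map C).map ψ = f.map C := by
      rw [hf, map_map, map_map]
      congr 1
      ext; simp [hψ]
    have h2 : R.natDegree = f.natDegree := (natDegree_map_eq_of_injective hinj R).symm
    rw [h1, h2, resultant_map_C_eq_prod_eval _ _ (natDegree_map_le.trans hP)]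
    simp only [eval_map]
    rfl
  have hf0 : f ≠ 0 := (Polynomial.map_ne_zero_iff hinj).2 hR
  have hr0 : r ≠ 0 := by
    intro h0
    rw [h0, map_zero] at key
    refine mul_ne_zero (pow_ne_zero _ (C_ne_zero.2 (leadingCoeff_ne_zero.2 hf0))) ?_ key.symm
    refine Multiset.prod_ne_zero fun h0 => ?_
    obtain ⟨z, hz, hz0⟩ := Multiset.mem_map.1 h0
    exact h z hz hz0
  -- Leading coefficients in `T` are multiplicative, so the left side is the norm of a nonzero
  -- integer and the right side is the product to be bounded.
  have hlc := congrArg (fun p : ℂ[X] => ‖p.leadingCoeff‖) key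
  simp only [leadingCoeff_mul, leadingCoeff_pow, leadingCoeff_C, leadingCoeff_multiset_prod,
    norm_mul, norm_pow, Multiset.map_map] at hlc
  have h3 : ‖(Multiset.map (leadingCoeff ∘ fun z => specializeAt z P) f.roots).prod‖ =
      (f.roots.map fun z => ‖(specializeAt z P).leadingCoeff‖).prod := by
    rw [← normHom_apply, map_multiset_prod, Multiset.map_map]; rfl
  have h4 : ‖f.leadingCoeff‖ = |(R.leadingCoeff : ℝ)| := by
    rw [hf, leadingCoeff_map_of_injective hinj]; simp
  have h5 : ‖(ψ r).leadingCoeff‖ = |(r.leadingCoeff : ℝ)| := by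
    rw [hψ, coe_mapRingHom, leadingCoeff_map_of_injective hinj]; simp
  rw [← h3, ← h4, ← hlc, h5]
  exact_mod_cast Int.one_le_abs (leadingCoeff_ne_zero.2 hr0)

end Polynomial

/-! ### Fibers of bivariate polynomials and their degrees -/

theorem specializeAt_asPolyInFst (F : MvPolynomial (Fin 2) ℤ) (z : ℂ) :
    specializeAt z (asPolyInFst F) = fiberPoly F z := by
  have : (specializeAt z).comp
      (MvPolynomial.aeval ![X, C X] : MvPolynomial (Fin 2) ℤ →ₐ[ℤ] ℤ[X][X]).toRingHom =
      (MvPolynomial.aeval ![C z, X] : MvPolynomial (Fin 2) ℤ →ₐ[ℤ] ℂ[X]).toRingHom := by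
    apply MvPolynomial.ringHom_ext
    · intro r; simp
    · intro i; fin_cases i <;> simp [specializeAt]
  exact congrArg (fun φ => φ F) this

theorem asPolyInSnd_map_specializeAt (F : MvPolynomial (Fin 2) ℤ) (z : ℂ) :
    (asPolyInSnd F).map (specializeAt z) = (fiberPoly F z).map C := by
  have : (mapRingHom (specializeAt z) : ℤ[X][X][X] →+* ℂ[X][X]).comp
      (MvPolynomial.aeval (![C X, X] : Fin 2 → ℤ[X][X][X]) :
        MvPolynomial (Fin 2) ℤ →ₐ[ℤ] ℤ[X][X][X]).toRingHom =
      (mapRingHom (C : ℂ →+* ℂ[X])).comp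
        (MvPolynomial.aeval ![C z, X] : MvPolynomial (Fin 2) ℤ →ₐ[ℤ] ℂ[X]).toRingHom := by
    apply MvPolynomial.ringHom_ext
    · intro r; simp
    · intro i; fin_cases i <;> simp [specializeAt]
  exact congrArg (fun φ => φ F) this

theorem eval_fiberPoly (F : MvPolynomial (Fin 2) ℤ) (z z' : ℂ) :
    (fiberPoly F z).eval z' = evalInt₂ F z z' := by
  have : (evalRingHom z').comp
      (MvPolynomial.aeval ![C z, X] : MvPolynomial (Fin 2) ℤ →ₐ[ℤ] ℂ[X]).toRingHom =
      (MvPolynomial.aeval ![z, z'] : MvPolynomial (Fin 2) ℤ →ₐ[ℤ] ℂ).toRingHom := by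
    apply MvPolynomial.ringHom_ext
    · intro r; simp
    · intro i; fin_cases i <;> simp
  exact congrArg (fun φ => φ F) this

theorem MvPolynomial.aeval_fin_two_eq_sum {S : Type*} [CommRing S] [Algebra ℤ S]
    (F : MvPolynomial (Fin 2) ℤ) (x y : S) : aeval ![x, y] F =
      ∑ d ∈ F.support, ((MvPolynomial.coeff d F : ℤ) : S) * (x ^ d 0 * y ^ d 1) := by
  rw [aeval_def, eval₂_eq']
  simp [Fin.prod_univ_two]

theorem MvPolynomial.apply_le_of_totalDegree_le {K : Type*} [CommSemiring K]
    {F : MvPolynomial (Fin 2) K} {n : ℕ} (hF : F.totalDegree ≤ n) {d : Fin 2 →₀ ℕ}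
    (hd : d ∈ F.support) (i : Fin 2) : d i ≤ n := by
  have h := (le_totalDegree hd).trans hF
  rw [Finsupp.sum_fintype _ _ (fun _ => rfl), Fin.sum_univ_two] at h
  fin_cases i <;> simp <;> omega

theorem natDegree_asPolyInFst_le {F : MvPolynomial (Fin 2) ℤ} {n : ℕ} (hF : F.totalDegree ≤ n) :
    (asPolyInFst F).natDegree ≤ n := by
  rw [asPolyInFst, MvPolynomial.aeval_fin_two_eq_sum]
  refine natDegree_sum_le_of_forall_le _ _ fun d hd => ?_
  rw [← C_pow, ← mul_assoc, ← C_eq_intCast, mul_right_comm, ← C_mul]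
  exact (natDegree_C_mul_X_pow_le _ _).trans (MvPolynomial.apply_le_of_totalDegree_le hF hd 0)

theorem natDegree_fiberPoly_le {F : MvPolynomial (Fin 2) ℤ} {n : ℕ} (hF : F.totalDegree ≤ n)
    (z : ℂ) : (fiberPoly F z).natDegree ≤ n := by
  rw [fiberPoly, MvPolynomial.aeval_fin_two_eq_sum]
  refine natDegree_sum_le_of_forall_le _ _ fun d hd => ?_
  rw [← C_pow, ← mul_assoc, ← C_eq_intCast, ← C_mul]
  exact (natDegree_C_mul_X_pow_le _ _).trans (MvPolynomial.apply_le_of_totalDegree_le hF hd 1)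

theorem asPolyInSnd_eq_sum (F : MvPolynomial (Fin 2) ℤ) : asPolyInSnd F =
    ∑ d ∈ F.support, ((F.coeff d : ℤ) : ℤ[X][X][X]) * (C X ^ d 0 * X ^ d 1) := by
  rw [asPolyInSnd, MvPolynomial.aeval_def, MvPolynomial.eval₂_eq']
  simp [Fin.prod_univ_two]

theorem natDegree_asPolyInSnd_le {F : MvPolynomial (Fin 2) ℤ} {n : ℕ} (hF : F.totalDegree ≤ n) :
    (asPolyInSnd F).natDegree ≤ n := by
  rw [asPolyInSnd_eq_sum]
  refine natDegree_sum_le_of_forall_le _ _ fun d hd => ?_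
  rw [← C_pow, ← mul_assoc, ← C_eq_intCast, ← C_mul]
  exact (natDegree_C_mul_X_pow_le _ _).trans (MvPolynomial.apply_le_of_totalDegree_le hF hd 1)

theorem natDegree_coeff_asPolyInSnd_le {F : MvPolynomial (Fin 2) ℤ} {n : ℕ}
    (hF : F.totalDegree ≤ n) (k : ℕ) : ((asPolyInSnd F).coeff k).natDegree ≤ n := by
  rw [asPolyInSnd_eq_sum, finsetSum_coeff]
  refine natDegree_sum_le_of_forall_le _ _ fun d hd => ?_
  rw [← C_pow, ← mul_assoc, ← C_eq_intCast, ← C_mul, coeff_C_mul_X_pow]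
  split_ifs
  · rw [← C_eq_intCast]
    exact (natDegree_C_mul_X_pow_le _ _).trans (MvPolynomial.apply_le_of_totalDegree_le hF hd 0)
  · simp

/-! ### The resultant of `F` with the pencil -/

section Pencil

variable {m n : ℕ} {G : Fin m → MvPolynomial (Fin 2) ℤ}

theorem natDegree_coeff_pencil_le (hG : ∀ j, (G j).totalDegree ≤ n) (k : ℕ) :
    ((pencil G n).coeff k).natDegree ≤ n := by
  rw [pencil, coeff_add, finsetSum_coeff]
  refine natDegree_add_le_of_degree_le (natDegree_sum_le_of_forall_le _ _ fun j _ => ?_) ?_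
  · rw [coeff_C_mul]
    exact (natDegree_C_mul_le _ _).trans (natDegree_coeff_asPolyInSnd_le (hG j) k)
  · rw [coeff_X_pow]
    split_ifs <;> simp

theorem natDegree_pencil_le (hG : ∀ j, (G j).totalDegree ≤ n) :
    (pencil G n).natDegree ≤ n + 1 := by
  refine natDegree_add_le_of_degree_le (natDegree_sum_le_of_forall_le _ _ fun j _ => ?_) (by simp)
  exact (natDegree_C_mul_le _ _).trans ((natDegree_asPolyInSnd_le (hG j)).trans n.le_succ)

/-- This is the purpose of the summand `Y ^ (n + 1)`: the pencil is monic in `Y`, so a fiber of `F`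
whose degree drops changes the resultant only by a sign. -/
theorem coeff_succ_pencil (hG : ∀ j, (G j).totalDegree ≤ n) :
    (pencil G n).coeff (n + 1) = 1 := by
  rw [pencil, coeff_add, finsetSum_coeff, Finset.sum_eq_zero, coeff_X_pow_self, zero_add]
  intro j _
  rw [coeff_C_mul, coeff_eq_zero_of_natDegree_lt, mul_zero]
  exact (natDegree_asPolyInSnd_le (hG j)).trans_lt n.lt_succ_self

theorem eval_pencil_map_specializeAt (z z' : ℂ) :
    ((pencil G n).map (specializeAt z)).eval (C z') =
      ∑ j : Fin m, X ^ (m - (j : ℕ)) * C (evalInt₂ (G j) z z') + C (z' ^ (n + 1)) := by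
  simp only [pencil, Polynomial.map_add, Polynomial.map_sum, Polynomial.map_mul, map_C,
    asPolyInSnd_map_specializeAt, eval_add, eval_finsetSum, eval_mul, eval_C, Polynomial.map_pow,
    map_X, eval_pow, eval_X, C_pow]
  congr 1
  refine Finset.sum_congr rfl fun j _ => ?_
  rw [← eval_fiberPoly, eval_map, eval₂_at_apply]
  simp [specializeAt]

/-- The leading coefficient in `T` of the resultant in `Y` of `F` and the pencil, at `X = z`. -/
theorem norm_leadingCoeff_specializeAt_resultant {F : MvPolynomial (Fin 2) ℤ} {n₁ : ℕ}
    (hF : F.totalDegree ≤ n₁) (hG : ∀ j, (G j).totalDegree ≤ n) (z : ℂ) {i : ℂ → Fin m}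
    (hi : ∀ z' ∈ (fiberPoly F z).roots, IsLeast {j | evalInt₂ (G j) z z' ≠ 0} (i z')) :
    ‖(specializeAt z (resultant (asPolyInSnd F) (pencil G n) n₁ (n + 1))).leadingCoeff‖ =
      ‖(fiberPoly F z).leadingCoeff‖ ^ (n + 1) *
        ((fiberPoly F z).roots.map fun z' => ‖evalInt₂ (G (i z')) z z'‖).prod := by
  -- The resultant is taken with formal degree `n₁`, while the fiber at `z` may have degree smaller
  -- by `k`. The defect contributes a sign and the `k`-th power of the top coefficient of the
  -- pencil, which is 1.
  obtain ⟨k, hk⟩ := exists_add_of_le (natDegree_fiberPoly_le hF z)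
  have hdeg : ((pencil G n).map (specializeAt z)).natDegree ≤ n + 1 :=
    natDegree_map_le.trans (natDegree_pencil_le hG)
  rw [← resultant_map_map, asPolyInSnd_map_specializeAt, hk,
    resultant_add_left_deg _ _ _ _ _ natDegree_map_le, coeff_map, coeff_succ_pencil hG, map_one,
    one_pow, mul_one, resultant_map_C_eq_prod_eval _ _ hdeg]
  have h1 : ∀ z' ∈ (fiberPoly F z).roots,
      (((pencil G n).map (specializeAt z)).eval (C z')).leadingCoeff =
        evalInt₂ (G (i z')) z z' := fun z' hz' => by
    rw [eval_pencil_map_specializeAt, leadingCoeff_sum_X_pow_add_C _ _ (hi z' hz')]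
  simp only [leadingCoeff_mul, leadingCoeff_pow, leadingCoeff_C, leadingCoeff_multiset_prod,
    norm_mul, norm_pow, Multiset.map_map, leadingCoeff_neg, leadingCoeff_one, norm_neg, norm_one,
    one_pow, one_mul]
  congr 1
  rw [← normHom_apply, map_multiset_prod, Multiset.map_map]
  refine congrArg Multiset.prod (Multiset.map_congr rfl fun z' hz' => ?_)
  simp only [Function.comp_apply, h1 z' hz', normHom_apply]

end Pencil

/-! ### Binary logarithms and Mahler measure -/

/-- `log₂ (max 1 x)`, the positive part of the binary logarithm. -/
noncomputable def logbPlus (x : ℝ) : ℝ :=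
  Real.logb 2 (max 1 x)

theorem logbPlus_nonneg (x : ℝ) : 0 ≤ logbPlus x :=
  Real.logb_nonneg one_lt_two (le_max_left _ _)

theorem two_rpow_logbPlus (x : ℝ) : (2 : ℝ) ^ logbPlus x = max 1 x :=
  Real.rpow_logb two_pos (by norm_num) (zero_lt_one.trans_le (le_max_left _ _))

theorem logb_le_of_le_two_rpow {x y : ℝ} (hx : 0 < x) (h : x ≤ 2 ^ y) : Real.logb 2 x ≤ y :=
  (Real.logb_le_iff_le_rpow one_lt_two hx).2 h

theorem two_rpow_logb_natCast_add_one (n : ℕ) : (2 : ℝ) ^ Real.logb 2 ((n : ℝ) + 1) = n + 1 :=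
  Real.rpow_logb two_pos (by norm_num) (by positivity)

theorem logb_natCast_add_one_nonneg (n : ℕ) : 0 ≤ Real.logb 2 ((n : ℝ) + 1) :=
  Real.logb_nonneg one_lt_two (by simp)

/-- Splits (b) into an upper bound for positive parts and a lower bound for the signed sum. The
convention `Real.logb 2 0 = 0` makes it valid at `x = 0` too. -/
theorem abs_logb_eq {x : ℝ} (hx : 0 ≤ x) :
    |Real.logb 2 x| = 2 * logbPlus x - Real.logb 2 x := by
  rcases le_total x 1 with h | h
  · rw [logbPlus, max_eq_left h, abs_of_nonpos (Real.logb_nonpos one_lt_two hx h)]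
    simp
  · rw [logbPlus, max_eq_right h, abs_of_nonneg (Real.logb_nonneg one_lt_two h)]
    ring

theorem logb_le_logbPlus {x : ℝ} (hx : 0 ≤ x) : Real.logb 2 x ≤ logbPlus x := by
  have h1 := abs_logb_eq hx
  have h2 := le_abs_self (Real.logb 2 x)
  linarith

theorem logb_multiset_prod {α : Type*} (s : Multiset α) {f : α → ℝ} (hf : ∀ a ∈ s, f a ≠ 0) :
    Real.logb 2 (s.map f).prod = (s.map fun a => Real.logb 2 (f a)).sum := by
  induction s using Multiset.induction with
  | empty => simp
  | cons a s ih =>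
    have hs : ∀ b ∈ s, f b ≠ 0 := fun b hb => hf b (Multiset.mem_cons_of_mem hb)
    have h0 : (s.map f).prod ≠ 0 := Multiset.prod_ne_zero fun h => by
      obtain ⟨b, hb, hb0⟩ := Multiset.mem_map.1 h
      exact hs b hb hb0
    simp only [Multiset.map_cons, Multiset.prod_cons, Multiset.sum_cons]
    rw [Real.logb_mul (hf a (Multiset.mem_cons_self a s)) h0, ih hs]

/-- The left side is the logarithm of the Mahler measure of `p`, which is at most the sum of the
norms of its coefficients, here at most `n + 1` terms of size `2 ^ K`. -/
theorem sum_logbPlus_norm_roots_le {p : ℂ[X]} (hp : p ≠ 0) {n : ℕ} (hn : p.natDegree ≤ n) {K : ℝ}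
    (hK : ∀ k, ‖p.coeff k‖ ≤ 2 ^ K) :
    (p.roots.map fun a => logbPlus ‖a‖).sum + Real.logb 2 ‖p.leadingCoeff‖ ≤
      Real.logb 2 (n + 1) + K := by
  have hlc : ‖p.leadingCoeff‖ ≠ 0 := norm_ne_zero_iff.2 (leadingCoeff_ne_zero.2 hp)
  have hmax : ∀ a ∈ p.roots, max 1 ‖a‖ ≠ 0 := fun a _ =>
    (zero_lt_one.trans_le (le_max_left _ _)).ne'
  have hprod : (p.roots.map fun a => max 1 ‖a‖).prod ≠ 0 :=
    (zero_lt_one.trans_le (one_le_prod_max_one_norm_roots p)).ne'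
  have h1 : (p.roots.map fun a => logbPlus ‖a‖).sum + Real.logb 2 ‖p.leadingCoeff‖ =
      Real.logb 2 p.mahlerMeasure := by
    rw [mahlerMeasure_eq_leadingCoeff_mul_prod_roots, Real.logb_mul hlc hprod,
      logb_multiset_prod _ hmax, add_comm]
    rfl
  rw [h1]
  refine logb_le_of_le_two_rpow (mahlerMeasure_pos_of_ne_zero hp) ?_
  rw [Real.rpow_add two_pos, two_rpow_logb_natCast_add_one]
  refine (mahlerMeasure_le_sum_norm_coeff p).trans ?_
  rw [sum_over_range' _ (by simp) (n + 1) (by omega)]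
  refine (Finset.sum_le_sum fun k _ => hK k).trans ?_
  simp

/-! ### Sizes of values and of fiber coefficients -/

section Bounds

variable {n : ℕ} {τ : ℝ}

theorem MvPolynomial.card_support_le {K : Type*} [CommSemiring K] {F : MvPolynomial (Fin 2) K}
    (hF : F.totalDegree ≤ n) : F.support.card ≤ (n + 1) ^ 2 := by
  have : F.support.card ≤ (Finset.range (n + 1) ×ˢ Finset.range (n + 1)).card := by
    refine Finset.card_le_card_of_injOn (fun d => (d 0, d 1)) (fun d hd => ?_) ?_
    · have h0 := apply_le_of_totalDegree_le hF hd 0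
      have h1 := apply_le_of_totalDegree_le hF hd 1
      simp only [Finset.coe_product, Finset.coe_range, Set.mem_prod, Set.mem_Iio]
      omega
    · intro d _ e _ h
      ext i
      have := Prod.ext_iff.1 h
      fin_cases i
      exacts [this.1, this.2]
  simpa [sq] using this

theorem norm_pow_le_max_one_pow (z : ℂ) {k : ℕ} (hk : k ≤ n) : ‖z ^ k‖ ≤ max 1 ‖z‖ ^ n := by
  rw [norm_pow]
  exact (pow_le_pow_left₀ (norm_nonneg z) (le_max_right _ _) k).trans
    (pow_le_pow_right₀ (le_max_left _ _) hk)

/-- There are at most `(n + 1) ^ 2` monomials, whence `2 log (n + 1)`; each is bounded by replacing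
`|z|` and `|z'|` by their maxima with 1 and both exponents by `n`. -/
theorem logbPlus_norm_evalComplex₂_le (hτ : 0 ≤ τ) {G : MvPolynomial (Fin 2) ℂ}
    (hG : G.totalDegree ≤ n) (hc : ∀ d, ‖G.coeff d‖ ≤ (2 : ℝ) ^ τ) (z z' : ℂ) :
    logbPlus ‖evalComplex₂ G z z'‖ ≤
      τ + 2 * Real.logb 2 (n + 1) + n * (logbPlus ‖z‖ + logbPlus ‖z'‖) := by
  have h0 := logbPlus_nonneg ‖z‖
  have h1 := logbPlus_nonneg ‖z'‖
  have h2 := logb_natCast_add_one_nonneg n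
  refine logb_le_of_le_two_rpow (zero_lt_one.trans_le (le_max_left _ _)) (max_le ?_ ?_)
  · exact Real.one_le_rpow one_le_two (by positivity)
  have hR : (2 : ℝ) ^ (τ + 2 * Real.logb 2 (n + 1) + n * (logbPlus ‖z‖ + logbPlus ‖z'‖)) =
      (n + 1) ^ 2 * (2 ^ τ * (max 1 ‖z‖ ^ n * max 1 ‖z'‖ ^ n)) := by
    rw [Real.rpow_add two_pos, Real.rpow_add two_pos, mul_comm (2 : ℝ) (Real.logb 2 _),
      Real.rpow_mul two_pos.le, two_rpow_logb_natCast_add_one, mul_comm (n : ℝ),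
      Real.rpow_mul_natCast two_pos.le, Real.rpow_add two_pos, two_rpow_logbPlus,
      two_rpow_logbPlus, mul_pow, Real.rpow_ofNat]
    ring
  rw [hR, evalComplex₂, MvPolynomial.eval_eq']
  refine (norm_sum_le_of_le (f := fun d : Fin 2 →₀ ℕ => MvPolynomial.coeff d G *
    ∏ i, ![z, z'] i ^ d i) _ (n := fun _ => 2 ^ τ * (max 1 ‖z‖ ^ n * max 1 ‖z'‖ ^ n))
    fun d hd => ?_).trans ?_
  · simp only [Fin.prod_univ_two, Matrix.cons_val_zero, Matrix.cons_val_one, norm_mul]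
    gcongr
    · exact hc d
    · exact norm_pow_le_max_one_pow z (MvPolynomial.apply_le_of_totalDegree_le hG hd 0)
    · exact norm_pow_le_max_one_pow z' (MvPolynomial.apply_le_of_totalDegree_le hG hd 1)
  · rw [Finset.sum_const, nsmul_eq_mul]
    gcongr
    exact_mod_cast MvPolynomial.card_support_le hG

theorem evalInt₂_eq_evalComplex₂_map (G : MvPolynomial (Fin 2) ℤ) (z z' : ℂ) :
    evalInt₂ G z z' = evalComplex₂ (MvPolynomial.map (Int.castRingHom ℂ) G) z z' := by
  rw [evalInt₂, evalComplex₂, MvPolynomial.eval_map, MvPolynomial.aeval_def]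
  rfl

theorem logbPlus_norm_evalInt₂_le (hτ : 0 ≤ τ) {G : MvPolynomial (Fin 2) ℤ}
    (hG : HasMagnitude₂ G n τ) (z z' : ℂ) :
    logbPlus ‖evalInt₂ G z z'‖ ≤
      τ + 2 * Real.logb 2 (n + 1) + n * (logbPlus ‖z‖ + logbPlus ‖z'‖) := by
  rw [evalInt₂_eq_evalComplex₂_map]
  refine logbPlus_norm_evalComplex₂_le hτ ?_ (fun d => ?_) z z'
  · exact (Finset.sup_mono (MvPolynomial.support_map_subset _ _)).trans hG.1
  · simpa [MvPolynomial.coeff_map] using hG.2 d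

theorem norm_coeff_fiberPoly_le {F : MvPolynomial (Fin 2) ℤ} (hF : HasMagnitude₂ F n τ)
    (z : ℂ) (k : ℕ) : ‖(fiberPoly F z).coeff k‖ ≤
      2 ^ (τ + 2 * Real.logb 2 (n + 1) + n * logbPlus ‖z‖) := by
  have hR : (2 : ℝ) ^ (τ + 2 * Real.logb 2 (n + 1) + n * logbPlus ‖z‖) =
      (n + 1) ^ 2 * (2 ^ τ * max 1 ‖z‖ ^ n) := by
    rw [Real.rpow_add two_pos, Real.rpow_add two_pos, mul_comm (2 : ℝ) (Real.logb 2 _),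
      Real.rpow_mul two_pos.le, two_rpow_logb_natCast_add_one, mul_comm (n : ℝ),
      Real.rpow_mul_natCast two_pos.le, two_rpow_logbPlus, Real.rpow_ofNat]
    ring
  rw [hR, fiberPoly, MvPolynomial.aeval_fin_two_eq_sum, finsetSum_coeff]
  refine (norm_sum_le_of_le (n := fun _ => 2 ^ τ * max 1 ‖z‖ ^ n) _ fun d hd => ?_).trans ?_
  · rw [← C_pow, ← mul_assoc, ← C_eq_intCast, ← C_mul, coeff_C_mul_X_pow]
    split_ifs
    · rw [norm_mul]
      gcongr
      · simpa using hF.2 d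
      · exact norm_pow_le_max_one_pow z (MvPolynomial.apply_le_of_totalDegree_le hF.1 hd 0)
    · rw [norm_zero]
      positivity
  · rw [Finset.sum_const, nsmul_eq_mul]
    gcongr
    exact_mod_cast MvPolynomial.card_support_le hF.1

end Bounds

/-! ### Sums over pairs of roots -/

/-- The complex roots of `R` with multiplicity. -/
noncomputable def complexRoots (R : ℤ[X]) : Multiset ℂ :=
  (R.map (Int.castRingHom ℂ)).roots

/-- The sum of `h` over all pairs of a root of `R` and a root of the fiber of `F` above it,
counted with multiplicity. -/
noncomputable def sumRootPairs (R : ℤ[X]) (F : MvPolynomial (Fin 2) ℤ) (h : ℂ → ℂ → ℝ) : ℝ :=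
  ((complexRoots R).map fun z => ((fiberPoly F z).roots.map (h z)).sum).sum

section Roots

variable {R : ℤ[X]} {F : MvPolynomial (Fin 2) ℤ}

theorem mem_complexRoots (hR : R ≠ 0) {z : ℂ} : z ∈ complexRoots R ↔ aeval z R = 0 := by
  rw [complexRoots, mem_roots ((Polynomial.map_ne_zero_iff Int.cast_injective).2 hR), IsRoot,
    eval_map, aeval_def]
  rfl

theorem card_complexRoots_le {N : ℕ} (hR : R.natDegree ≤ N) : (complexRoots R).card ≤ N :=
  (card_roots' _).trans (natDegree_map_le.trans hR)

/-- A vanishing fiber would put the whole line over `z` into the zero locus, contradicting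
finiteness. -/
theorem fiberPoly_ne_zero (hR : R ≠ 0) (hfin : (zeroLocus₂ R F).Finite) {z : ℂ}
    (hz : z ∈ complexRoots R) : fiberPoly F z ≠ 0 := by
  intro h
  have hsub : Set.range (fun z' : ℂ => (z, z')) ⊆ zeroLocus₂ R F := by
    rintro _ ⟨z', rfl⟩
    exact ⟨(mem_complexRoots hR).1 hz, by rw [← eval_fiberPoly, h, eval_zero]⟩
  exact Set.infinite_range_of_injective (Prod.mk_right_injective z) (hfin.subset hsub)

/-- By convention every point has multiplicity 0 as a root of the zero polynomial. -/
theorem weightedSum_zero_left (A : Set (ℂ × ℂ)) (h : ℂ → ℂ → ℝ) : weightedSum 0 A h = 0 := by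
  simp [weightedSum, multC]

theorem mem_roots_fiberPoly {z z' : ℂ} (h0 : fiberPoly F z ≠ 0) :
    z' ∈ (fiberPoly F z).roots ↔ evalInt₂ F z z' = 0 := by
  rw [mem_roots h0, IsRoot, eval_fiberPoly]

/-- As `h'` is nonnegative, counting the `z'` with multiplicity and adding the pairs outside `A` can
only increase the sum. -/
theorem weightedSum_le_sumRootPairs (hR : R ≠ 0) (hfin : (zeroLocus₂ R F).Finite)
    {A : Set (ℂ × ℂ)} (hA : A ⊆ zeroLocus₂ R F) {h h' : ℂ → ℂ → ℝ}
    (hle : ∀ z z', (z, z') ∈ A → h z z' ≤ h' z z') (h0 : ∀ z z', 0 ≤ h' z z') :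
    weightedSum R A h ≤ sumRootPairs R F h' := by
  classical
  have hset : rootSetC R = ((complexRoots R).toFinset : Set ℂ) := by
    ext z; simp [rootSetC, mem_complexRoots hR]
  rw [weightedSum, hset, finsum_mem_coe_finset, sumRootPairs, Finset.sum_multiset_map_count]
  refine Finset.sum_le_sum fun z hz => ?_
  rw [Multiset.mem_toFinset] at hz
  rw [nsmul_eq_mul, multC, ← count_roots, ← complexRoots]
  gcongr
  have hF0 := fiberPoly_ne_zero hR hfin hz
  set s := (fiberPoly F z).roots.toFinset.filter (· ∈ fiberAt A z) with hs
  have hfib : fiberAt A z = (s : Set ℂ) := by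
    ext z'
    simp only [hs, Finset.coe_filter, Multiset.mem_toFinset, Set.mem_ofPred_eq]
    exact ⟨fun hz' => ⟨(mem_roots_fiberPoly hF0).2 (hA hz').2, hz'⟩, And.right⟩
  rw [hfib, finsum_mem_coe_finset, Finset.sum_multiset_map_count]
  calc ∑ z' ∈ s, h z z' ≤ ∑ z' ∈ s, (fiberPoly F z).roots.count z' • h' z z' := by
        refine Finset.sum_le_sum fun z' hz' => ?_
        obtain ⟨hz'r, hz'A⟩ := Finset.mem_filter.1 hz'
        have hc : 1 ≤ (fiberPoly F z).roots.count z' :=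
          Multiset.one_le_count_iff_mem.2 (Multiset.mem_toFinset.1 hz'r)
        refine (hle z z' hz'A).trans ?_
        simpa using nsmul_le_nsmul_left (h0 z z') hc
    _ ≤ _ := Finset.sum_le_sum_of_subset_of_nonneg (Finset.filter_subset _ _)
        fun z' _ _ => nsmul_nonneg (h0 z z') _

end Roots

/-! ### Upper and lower estimates over the roots -/

theorem Multiset.sum_map_le_of_forall_le {α : Type*} {s : Multiset α} {N : ℕ} (hs : s.card ≤ N)
    {a b c : ℝ} (ha : 0 ≤ a) {f g h : α → ℝ} (hf : ∀ x ∈ s, f x ≤ a + b * g x - c * h x) :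
    (s.map f).sum ≤ N * a + b * (s.map g).sum - c * (s.map h).sum := by
  have h1 : (s.map f).sum ≤ s.card * a + b * (s.map g).sum - c * (s.map h).sum := by
    refine (Multiset.sum_map_le_sum_map f _ hf).trans_eq ?_
    rw [Multiset.sum_map_sub, Multiset.sum_map_add, Multiset.sum_map_mul_left,
      Multiset.sum_map_mul_left, Multiset.map_const', Multiset.sum_replicate, nsmul_eq_mul]
  have h2 : (s.card : ℝ) * a ≤ N * a := by gcongr
  linarith

section Integrality

variable {R : ℤ[X]} {F : MvPolynomial (Fin 2) ℤ}

theorem abs_leadingCoeff_ge_one (hR : R ≠ 0) : 1 ≤ |(R.leadingCoeff : ℝ)| :=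
  mod_cast Int.one_le_abs (leadingCoeff_ne_zero.2 hR)

theorem logb_abs_leadingCoeff_le {N : ℕ} {Λ : ℝ} (hR : R ≠ 0) (hmag : HasMagnitude R N Λ) :
    Real.logb 2 |(R.leadingCoeff : ℝ)| ≤ Λ :=
  logb_le_of_le_two_rpow (zero_lt_one.trans_le (abs_leadingCoeff_ge_one hR)) (hmag.2 _)

/-- Logarithmic form of the integrality of the resultant with `R`; the power `D` of the leading
coefficient of `R` costs at most `D * Λ`. -/
theorem neg_le_sum_logb_norm_leadingCoeff {N D : ℕ} {Λ : ℝ} (hR : R ≠ 0)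
    (hmag : HasMagnitude R N Λ) {P : ℤ[X][X]} (hP : P.natDegree ≤ D)
    (h : ∀ z ∈ complexRoots R, specializeAt z P ≠ 0) :
    -(D * Λ) ≤ ((complexRoots R).map
      fun z => Real.logb 2 ‖(specializeAt z P).leadingCoeff‖).sum := by
  have hne : ∀ z ∈ complexRoots R, ‖(specializeAt z P).leadingCoeff‖ ≠ 0 := fun z hz =>
    norm_ne_zero_iff.2 (leadingCoeff_ne_zero.2 (h z hz))
  have h1 := one_le_norm_leadingCoeff_pow_mul_prod hR hP h
  have hlc := abs_leadingCoeff_ge_one hR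
  have h2 := Real.logb_nonneg one_lt_two h1
  have hprod : ((R.map (Int.castRingHom ℂ)).roots.map
      fun z => ‖(specializeAt z P).leadingCoeff‖).prod ≠ 0 := by
    intro h0
    rw [h0, mul_zero] at h1
    linarith
  rw [Real.logb_mul (pow_ne_zero _ (by linarith)) hprod, Real.logb_pow, ← complexRoots,
    logb_multiset_prod _ hne] at h2
  have h3 : (D : ℝ) * Real.logb 2 |(R.leadingCoeff : ℝ)| ≤ D * Λ := by
    gcongr
    exact logb_abs_leadingCoeff_le hR hmag
  linarith

theorem sum_logbPlus_norm_complexRoots_le {N : ℕ} {Λ : ℝ} (hR : R ≠ 0)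
    (hmag : HasMagnitude R N Λ) :
    ((complexRoots R).map fun z => logbPlus ‖z‖).sum ≤ Λ + Real.logb 2 (N + 1) := by
  have h1 := sum_logbPlus_norm_roots_le (p := R.map (Int.castRingHom ℂ)) (n := N) (K := Λ)
    ((Polynomial.map_ne_zero_iff Int.cast_injective).2 hR) (natDegree_map_le.trans hmag.1)
    (fun k => by simpa using hmag.2 k)
  have h2 : 0 ≤ Real.logb 2 ‖(R.map (Int.castRingHom ℂ)).leadingCoeff‖ := by
    rw [leadingCoeff_map_of_injective Int.cast_injective]
    exact Real.logb_nonneg one_lt_two (by simpa using abs_leadingCoeff_ge_one hR)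
  rw [complexRoots]
  linarith

variable {N n₁ n₂ : ℕ} {Λ τ₁ τ₂ : ℝ}

/-- The integrality bound with `Y` in the role of `T`: the fiber leading coefficients cannot all be
very small. -/
theorem neg_le_sum_logb_norm_leadingCoeff_fiberPoly (hR : R ≠ 0) (hmag : HasMagnitude R N Λ)
    (hF : F.totalDegree ≤ n₁) (hfin : (zeroLocus₂ R F).Finite) :
    -(n₁ * Λ) ≤ ((complexRoots R).map
      fun z => Real.logb 2 ‖(fiberPoly F z).leadingCoeff‖).sum := by
  have h := neg_le_sum_logb_norm_leadingCoeff hR hmag (natDegree_asPolyInFst_le hF)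
    (fun z hz => by rw [specializeAt_asPolyInFst]; exact fiberPoly_ne_zero hR hfin hz)
  simpa only [specializeAt_asPolyInFst] using h

theorem logb_norm_leadingCoeff_fiberPoly_le (hF : HasMagnitude₂ F n₁ τ₁) {z : ℂ}
    (h0 : fiberPoly F z ≠ 0) : Real.logb 2 ‖(fiberPoly F z).leadingCoeff‖ ≤
      τ₁ + 2 * Real.logb 2 (n₁ + 1) + n₁ * logbPlus ‖z‖ :=
  logb_le_of_le_two_rpow (norm_pos_iff.2 (leadingCoeff_ne_zero.2 h0))
    (norm_coeff_fiberPoly_le hF z _)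

/-- The pairs of roots contribute at most the size of the data to any function with the growth
of a polynomial of degree `n₂` with coefficients of size `2 ^ τ₂`. -/
theorem sumRootPairs_le (hR : R ≠ 0) (hmag : HasMagnitude R N Λ) (hF : HasMagnitude₂ F n₁ τ₁)
    (hτ₁ : 0 ≤ τ₁) (hτ₂ : 0 ≤ τ₂) (hfin : (zeroLocus₂ R F).Finite) {h : ℂ → ℂ → ℝ}
    (hh : ∀ z z', h z z' ≤
      τ₂ + 2 * Real.logb 2 (n₂ + 1) + n₂ * (logbPlus ‖z‖ + logbPlus ‖z'‖)) :
    sumRootPairs R F h ≤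
      N * (n₁ * (τ₂ + 2 * Real.logb 2 (n₂ + 1)) + n₂ * (τ₁ + 3 * Real.logb 2 (n₁ + 1))) +
        2 * n₁ * n₂ * (Λ + Real.logb 2 (N + 1)) + n₂ * (n₁ * Λ) := by
  have hl₁ := logb_natCast_add_one_nonneg n₁
  have hl₂ := logb_natCast_add_one_nonneg n₂
  have hstep := Multiset.sum_map_le_of_forall_le (card_complexRoots_le hmag.1)
    -- Of the three `log (n₁ + 1)`, one is the Mahler bound for the fiber and two come from the size
    -- of its coefficients. In `b`, one `n₁ n₂` comes from `n₂ log⁺|z|` over at most `n₁` roots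
    -- `z'`, the other from the growth of the fiber coefficients in `z`.
    (a := n₁ * (τ₂ + 2 * Real.logb 2 (n₂ + 1)) + n₂ * (τ₁ + 3 * Real.logb 2 (n₁ + 1)))
    (b := 2 * n₁ * n₂) (c := n₂) (by positivity)
    (f := fun z => ((fiberPoly F z).roots.map (h z)).sum) (g := fun z => logbPlus ‖z‖)
    (h := fun z => Real.logb 2 ‖(fiberPoly F z).leadingCoeff‖) (fun z hz => by
      have h0 := fiberPoly_ne_zero hR hfin hz
      have hlz := logbPlus_nonneg ‖z‖
      have h1 := sum_logbPlus_norm_roots_le h0 (natDegree_fiberPoly_le hF.1 z)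
        (norm_coeff_fiberPoly_le hF z)
      have h2 := Multiset.sum_map_le_of_forall_le (s := (fiberPoly F z).roots) (N := n₁)
        ((card_roots' _).trans (natDegree_fiberPoly_le hF.1 z))
        (a := τ₂ + 2 * Real.logb 2 (n₂ + 1) + n₂ * logbPlus ‖z‖) (b := n₂) (c := 0)
        (by positivity) (f := h z) (g := fun z' => logbPlus ‖z'‖) (h := fun _ => 0)
        (fun z' _ => by have := hh z z'; linarith)
      have h3 := mul_le_mul_of_nonneg_left h1 (Nat.cast_nonneg (α := ℝ) n₂)
      linarith)
  have h1 := sum_logbPlus_norm_complexRoots_le hR hmag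
  have h2 := neg_le_sum_logb_norm_leadingCoeff_fiberPoly hR hmag hF.1 hfin
  have h3 := mul_le_mul_of_nonneg_left h1 (by positivity : (0 : ℝ) ≤ 2 * n₁ * n₂)
  have h4 := mul_le_mul_of_nonneg_left h2 (Nat.cast_nonneg (α := ℝ) n₂)
  rw [sumRootPairs]
  linarith

/-- The lower bound coming from the integrality of the iterated resultant. -/
theorem neg_le_sumRootPairs_logb (hR : R ≠ 0) (hmag : HasMagnitude R N Λ)
    (hF : HasMagnitude₂ F n₁ τ₁) (hτ₁ : 0 ≤ τ₁) (hfin : (zeroLocus₂ R F).Finite) {m : ℕ}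
    {G : Fin m → MvPolynomial (Fin 2) ℤ} (hG : ∀ j, (G j).totalDegree ≤ n₂) {i : ℂ → ℂ → Fin m}
    (hi : ∀ z z', (z, z') ∈ zeroLocus₂ R F →
      IsLeast {j | evalInt₂ (G j) z z' ≠ 0} (i z z')) :
    -((n₁ * n₂ + (n₂ + 1) * n₁) * Λ + (n₂ + 1) * (N * (τ₁ + 2 * Real.logb 2 (n₁ + 1)) +
        n₁ * (Λ + Real.logb 2 (N + 1)))) ≤
      sumRootPairs R F fun z z' => Real.logb 2 ‖evalInt₂ (G (i z z')) z z'‖ := by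
  have hl₁ := logb_natCast_add_one_nonneg n₁
  set P := resultant (asPolyInSnd F) (pencil G n₂) n₁ (n₂ + 1) with hP
  have hdeg : P.natDegree ≤ n₁ * n₂ + (n₂ + 1) * n₁ :=
    natDegree_resultant_le (natDegree_coeff_asPolyInSnd_le hF.1) (natDegree_coeff_pencil_le hG)
  have hleast : ∀ z ∈ complexRoots R, ∀ z' ∈ (fiberPoly F z).roots,
      IsLeast {j | evalInt₂ (G j) z z' ≠ 0} (i z z') := fun z hz z' hz' =>
    hi z z' ⟨(mem_complexRoots hR).1 hz,
      (mem_roots_fiberPoly (fiberPoly_ne_zero hR hfin hz)).1 hz'⟩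
  have hlead : ∀ z ∈ complexRoots R, ‖(specializeAt z P).leadingCoeff‖ =
      ‖(fiberPoly F z).leadingCoeff‖ ^ (n₂ + 1) *
        ((fiberPoly F z).roots.map fun z' => ‖evalInt₂ (G (i z z')) z z'‖).prod := fun z hz =>
    norm_leadingCoeff_specializeAt_resultant hF.1 hG z (hleast z hz)
  have hne : ∀ z ∈ complexRoots R, ∀ z' ∈ (fiberPoly F z).roots,
      ‖evalInt₂ (G (i z z')) z z'‖ ≠ 0 := fun z hz z' hz' =>
    norm_ne_zero_iff.2 (hleast z hz z' hz').1
  have hlc : ∀ z ∈ complexRoots R, ‖(fiberPoly F z).leadingCoeff‖ ^ (n₂ + 1) ≠ 0 := fun z hz =>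
    pow_ne_zero _ (norm_ne_zero_iff.2 (leadingCoeff_ne_zero.2 (fiberPoly_ne_zero hR hfin hz)))
  have hprod : ∀ z ∈ complexRoots R,
      ((fiberPoly F z).roots.map fun z' => ‖evalInt₂ (G (i z z')) z z'‖).prod ≠ 0 := by
    intro z hz h0
    obtain ⟨z', hz', h0⟩ := Multiset.mem_map.1 (Multiset.prod_eq_zero_iff.1 h0)
    exact hne z hz z' hz' h0
  have h1 := neg_le_sum_logb_norm_leadingCoeff hR hmag hdeg (fun z hz h0 => by
    have := hlead z hz
    rw [h0, leadingCoeff_zero, norm_zero] at this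
    exact mul_ne_zero (hlc z hz) (hprod z hz) this.symm)
  have h2 : ((complexRoots R).map fun z => Real.logb 2 ‖(specializeAt z P).leadingCoeff‖).sum =
      (n₂ + 1) * ((complexRoots R).map
        fun z => Real.logb 2 ‖(fiberPoly F z).leadingCoeff‖).sum +
      sumRootPairs R F fun z z' => Real.logb 2 ‖evalInt₂ (G (i z z')) z z'‖ := by
    rw [sumRootPairs, ← Multiset.sum_map_mul_left, ← Multiset.sum_map_add]
    refine congrArg Multiset.sum (Multiset.map_congr rfl fun z hz => ?_)
    rw [hlead z hz, Real.logb_mul (hlc z hz) (hprod z hz), Real.logb_pow,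
      logb_multiset_prod _ (hne z hz)]
    push_cast
    rfl
  -- The resultant also carries the fiber leading coefficients to the power `n₂ + 1`; to isolate the
  -- `G`-part, their contribution is bounded from above.
  have h3 := Multiset.sum_map_le_of_forall_le (card_complexRoots_le hmag.1)
    (a := τ₁ + 2 * Real.logb 2 (n₁ + 1)) (b := n₁) (c := 0) (by positivity)
    (f := fun z => Real.logb 2 ‖(fiberPoly F z).leadingCoeff‖) (g := fun z => logbPlus ‖z‖)
    (h := fun _ => 0) (fun z hz => by
      have := logb_norm_leadingCoeff_fiberPoly_le hF (fiberPoly_ne_zero hR hfin hz)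
      linarith)
  have h4 := mul_le_mul_of_nonneg_left (sum_logbPlus_norm_complexRoots_le hR hmag)
    (Nat.cast_nonneg (α := ℝ) n₁)
  have h5 : ((n₂ : ℝ) + 1) * ((complexRoots R).map
        fun z => Real.logb 2 ‖(fiberPoly F z).leadingCoeff‖).sum ≤
      (n₂ + 1) * (N * (τ₁ + 2 * Real.logb 2 (n₁ + 1)) + n₁ * (Λ + Real.logb 2 (N + 1))) := by
    gcongr
    linarith
  rw [h2] at h1
  push_cast at h1
  linarith

theorem logb_norm_evalInt₂_nonneg_of_totalDegree_eq_zero {G : MvPolynomial (Fin 2) ℤ}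
    (hG : G.totalDegree = 0) {z z' : ℂ} (h0 : evalInt₂ G z z' ≠ 0) :
    0 ≤ Real.logb 2 ‖evalInt₂ G z z'‖ := by
  rw [MvPolynomial.totalDegree_eq_zero_iff_eq_C.1 hG, evalInt₂] at h0 ⊢
  rw [MvPolynomial.aeval_C, eq_intCast] at h0 ⊢
  refine Real.logb_nonneg one_lt_two ?_
  rw [Complex.norm_intCast]
  exact_mod_cast Int.one_le_abs (Int.cast_ne_zero.1 h0)

end Integrality

/-! ### Absorbing the estimates into the soft-O bound -/

section SoftO

variable (N n₁ n₂ : ℕ) {Λ τ₁ τ₂ : ℝ}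

theorem one_le_logb_two_add {B : ℝ} (hB : 0 ≤ B) : 1 ≤ Real.logb 2 (2 + B) := by
  rw [Real.le_logb_iff_rpow_le one_lt_two (by linarith), Real.rpow_one]
  linarith

/-- The product `a * b` need not be at most `B` when `c = 0`, but then the logarithm vanishes. If `a
* b` and `c` are both positive, each is at most `B`. -/
theorem natCast_mul_logb_le {a b c : ℕ} {B : ℝ} (hB : (a * b * c : ℝ) ≤ B) :
    (a * b : ℝ) * Real.logb 2 (c + 1) ≤ B * Real.logb 2 (2 + B) := by
  have hB0 : 0 ≤ B := le_trans (by positivity) hB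
  have hL : 0 ≤ B * Real.logb 2 (2 + B) :=
    mul_nonneg hB0 (zero_le_one.trans (one_le_logb_two_add hB0))
  rcases Nat.eq_zero_or_pos (a * b) with hab | hab
  · have : (a * b : ℝ) = 0 := mod_cast hab
    rwa [this, zero_mul]
  rcases Nat.eq_zero_or_pos c with rfl | hc
  · simpa using hL
  have hab' : (1 : ℝ) ≤ a * b := mod_cast hab
  have hc' : (1 : ℝ) ≤ c := mod_cast hc
  have h1 : (a * b : ℝ) ≤ B := le_trans (le_mul_of_one_le_right (by linarith) hc') hB
  have h2 : (c : ℝ) ≤ B := le_trans (le_mul_of_one_le_left (by linarith) hab') hB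
  refine mul_le_mul h1 ?_ (logb_natCast_add_one_nonneg c) hB0
  exact Real.logb_le_logb_of_le one_lt_two (by linarith) (by linarith)

theorem upper_bound_le_softBound (hΛ : 0 ≤ Λ) (hτ₁ : 0 ≤ τ₁) (hτ₂ : 0 ≤ τ₂) :
    N * (n₁ * (τ₂ + 2 * Real.logb 2 (n₂ + 1)) + n₂ * (τ₁ + 3 * Real.logb 2 (n₁ + 1))) +
        2 * n₁ * n₂ * (Λ + Real.logb 2 (N + 1)) + n₂ * (n₁ * Λ) ≤
      softBound 10 1 (bivariateSize N n₁ n₂ Λ τ₁ τ₂) := by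
  set B := bivariateSize N n₁ n₂ Λ τ₁ τ₂ with hB
  have hB' : B = τ₂ * n₁ * N + τ₁ * n₂ * N + Λ * n₁ * n₂ + N * n₁ * n₂ := by
    rw [hB, bivariateSize]; ring
  have p1 : 0 ≤ τ₂ * n₁ * N := by positivity
  have p2 : 0 ≤ τ₁ * n₂ * N := by positivity
  have p3 : 0 ≤ Λ * n₁ * n₂ := by positivity
  have p4 : (0 : ℝ) ≤ N * n₁ * n₂ := by positivity
  have hBL : B * 1 ≤ B * Real.logb 2 (2 + B) :=
    mul_le_mul_of_nonneg_left (one_le_logb_two_add (by linarith)) (by linarith)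
  have q1 := natCast_mul_logb_le (a := N) (b := n₁) (c := n₂) (B := B) (by linarith)
  have q2 := natCast_mul_logb_le (a := N) (b := n₂) (c := n₁) (B := B) (by linarith)
  have q3 := natCast_mul_logb_le (a := n₁) (b := n₂) (c := N) (B := B) (by linarith)
  rw [softBound, pow_one]
  -- The constant is 10 = 2 + 3 + 2 from `q1`, `q2`, `q3`, plus 3 for the terms without logarithm,
  -- the largest coefficient there being that of `Λ * n₁ * n₂`.
  linarith

theorem lower_bound_le_softBound (hn₂ : 1 ≤ n₂) (hΛ : 0 ≤ Λ) (hτ₁ : 0 ≤ τ₁) (hτ₂ : 0 ≤ τ₂) :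
    (n₁ * n₂ + (n₂ + 1) * n₁) * Λ + (n₂ + 1) * (N * (τ₁ + 2 * Real.logb 2 (n₁ + 1)) +
        n₁ * (Λ + Real.logb 2 (N + 1))) ≤
      softBound 11 1 (bivariateSize N n₁ n₂ Λ τ₁ τ₂) := by
  set B := bivariateSize N n₁ n₂ Λ τ₁ τ₂ with hB
  have hB' : B = τ₂ * n₁ * N + τ₁ * n₂ * N + Λ * n₁ * n₂ + N * n₁ * n₂ := by
    rw [hB, bivariateSize]; ring
  have p1 : 0 ≤ τ₂ * n₁ * N := by positivity
  have p2 : 0 ≤ τ₁ * n₂ * N := by positivity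
  have p3 : 0 ≤ Λ * n₁ * n₂ := by positivity
  have p4 : (0 : ℝ) ≤ N * n₁ * n₂ := by positivity
  have hBL : B * 1 ≤ B * Real.logb 2 (2 + B) :=
    mul_le_mul_of_nonneg_left (one_le_logb_two_add (by linarith)) (by linarith)
  have q2 := natCast_mul_logb_le (a := N) (b := n₂) (c := n₁) (B := B) (by linarith)
  have q3 := natCast_mul_logb_le (a := n₁) (b := n₂) (c := N) (B := B) (by linarith)
  have hl₁ := logb_natCast_add_one_nonneg n₁
  have hlN := logb_natCast_add_one_nonneg N
  -- Trading `n₂ + 1` for `2 * n₂` is where `n₂ ≥ 1` matters. The constant is then 11 = 5 + 4 + 2: 5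
  -- without logarithm, the rest from `q2` and `q3`.
  have hn : (n₂ : ℝ) + 1 ≤ 2 * n₂ := by
    have : (1 : ℝ) ≤ n₂ := mod_cast hn₂
    linarith
  have r1 := mul_le_mul_of_nonneg_right hn (by positivity : 0 ≤ n₁ * Λ)
  have r2 := mul_le_mul_of_nonneg_right hn
    (by positivity : 0 ≤ N * (τ₁ + 2 * Real.logb 2 (n₁ + 1)) + n₁ * (Λ + Real.logb 2 (N + 1)))
  rw [softBound, pow_one]
  linarith

theorem softBound_nonneg {C : ℝ} (hC : 0 ≤ C) (k : ℕ) (hΛ : 0 ≤ Λ) (hτ₁ : 0 ≤ τ₁)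
    (hτ₂ : 0 ≤ τ₂) : 0 ≤ softBound C k (bivariateSize N n₁ n₂ Λ τ₁ τ₂) := by
  have hB : 0 ≤ bivariateSize N n₁ n₂ Λ τ₁ τ₂ := by rw [bivariateSize]; positivity
  exact mul_nonneg (mul_nonneg hC hB)
    (pow_nonneg (zero_le_one.trans (one_le_logb_two_add hB)) k)

end SoftO

/-! ### Assembly of the two bounds -/

theorem mainTheorem5 :
    -- (a)
    (∃ (C : ℝ) (k : ℕ),
      ∀ (N n₁ n₂ m : ℕ) (Λ τ₁ τ₂ : ℝ), 0 ≤ Λ → 0 ≤ τ₁ → 0 ≤ τ₂ →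
      ∀ (R : Polynomial ℤ) (F : MvPolynomial (Fin 2) ℤ),
        HasMagnitude R N Λ → HasMagnitude₂ F n₁ τ₁ → (zeroLocus₂ R F).Finite →
      ∀ G : Fin m → MvPolynomial (Fin 2) ℂ,
        (∀ j, (G j).totalDegree ≤ n₂ ∧ ∀ d : Fin 2 →₀ ℕ, ‖(G j).coeff d‖ ≤ (2 : ℝ) ^ τ₂) →
      ∀ (A : Set (ℂ × ℂ)), A ⊆ zeroLocus₂ R F →
      ∀ i : ℂ → ℂ → Fin m,
        (∀ z z', (z, z') ∈ A → evalComplex₂ (G (i z z')) z z' ≠ 0) →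
        weightedSum R A (fun z z' => Real.logb 2 ‖evalComplex₂ (G (i z z')) z z'‖) ≤
          softBound C k (bivariateSize N n₁ n₂ Λ τ₁ τ₂)) ∧
    -- (b)
    (∃ (C : ℝ) (k : ℕ),
      ∀ (N n₁ n₂ m : ℕ) (Λ τ₁ τ₂ : ℝ), 0 ≤ Λ → 0 ≤ τ₁ → 0 ≤ τ₂ →
      ∀ (R : Polynomial ℤ) (F : MvPolynomial (Fin 2) ℤ),
        HasMagnitude R N Λ → HasMagnitude₂ F n₁ τ₁ → (zeroLocus₂ R F).Finite →
      ∀ G : Fin m → MvPolynomial (Fin 2) ℤ, (∀ j, HasMagnitude₂ (G j) n₂ τ₂) →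
        (∀ z z', (z, z') ∈ zeroLocus₂ R F → ∃ j, evalInt₂ (G j) z z' ≠ 0) →
      ∀ i : ℂ → ℂ → Fin m,
        (∀ z z', (z, z') ∈ zeroLocus₂ R F →
          IsLeast {j | evalInt₂ (G j) z z' ≠ 0} (i z z')) →
        weightedSum R (zeroLocus₂ R F)
            (fun z z' => |Real.logb 2 ‖evalInt₂ (G (i z z')) z z'‖|) ≤
          softBound C k (bivariateSize N n₁ n₂ Λ τ₁ τ₂)) := by
  -- Here 31 = 2 * 10 + 11, from `|log x| = 2 log⁺ x - log x` with the upper constant 10 and the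
  -- lower constant 11.
  refine ⟨⟨10, 1, ?_⟩, ⟨31, 1, ?_⟩⟩
  · intro N n₁ n₂ m Λ τ₁ τ₂ hΛ hτ₁ hτ₂ R F hR hF hfin G hG A hA i _
    rcases eq_or_ne R 0 with rfl | hR0
    · rw [weightedSum_zero_left]
      exact softBound_nonneg N n₁ n₂ (by norm_num) 1 hΛ hτ₁ hτ₂
    refine (weightedSum_le_sumRootPairs hR0 hfin hA
      (h' := fun z z' => logbPlus ‖evalComplex₂ (G (i z z')) z z'‖)
      (fun z z' _ => logb_le_logbPlus (norm_nonneg _)) (fun z z' => logbPlus_nonneg _)).trans ?_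
    refine (sumRootPairs_le hR0 hR hF hτ₁ hτ₂ hfin fun z z' =>
      logbPlus_norm_evalComplex₂_le hτ₂ (hG _).1 (hG _).2 z z').trans ?_
    exact upper_bound_le_softBound N n₁ n₂ hΛ hτ₁ hτ₂
  · intro N n₁ n₂ m Λ τ₁ τ₂ hΛ hτ₁ hτ₂ R F hR hF hfin G hG _ i hi
    rcases eq_or_ne R 0 with rfl | hR0
    · rw [weightedSum_zero_left]
      exact softBound_nonneg N n₁ n₂ (by norm_num) 1 hΛ hτ₁ hτ₂
    have hup : sumRootPairs R F (fun z z' => logbPlus ‖evalInt₂ (G (i z z')) z z'‖) ≤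
        softBound 10 1 (bivariateSize N n₁ n₂ Λ τ₁ τ₂) :=
      (sumRootPairs_le hR0 hR hF hτ₁ hτ₂ hfin fun z z' =>
        logbPlus_norm_evalInt₂_le hτ₂ (hG _) z z').trans
        (upper_bound_le_softBound N n₁ n₂ hΛ hτ₁ hτ₂)
    -- For `n₂ = 0` the factor `n₂ + 1` of the lower bound is not controlled by the size, but then
    -- the chosen values are nonzero integer constants, with nonnegative logarithm, and the upper
    -- bound suffices.
    rcases Nat.eq_zero_or_pos n₂ with hn₂ | hn₂
    · refine (weightedSum_le_sumRootPairs hR0 hfin subset_rfl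
        (h' := fun z z' => logbPlus ‖evalInt₂ (G (i z z')) z z'‖) (fun z z' hz => ?_)
        (fun z z' => logbPlus_nonneg _)).trans (hup.trans ?_)
      · rw [abs_of_nonneg (logb_norm_evalInt₂_nonneg_of_totalDegree_eq_zero
          (Nat.le_zero.1 (hn₂ ▸ (hG _).1)) (hi z z' hz).1)]
        exact logb_le_logbPlus (norm_nonneg _)
      · have := softBound_nonneg N n₁ n₂ (C := 21) (by norm_num) 1 hΛ hτ₁ hτ₂
        unfold softBound at this ⊢
        linarith
    · refine (weightedSum_le_sumRootPairs hR0 hfin subset_rfl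
        (h' := fun z z' => |Real.logb 2 ‖evalInt₂ (G (i z z')) z z'‖|) (fun z z' _ => le_rfl)
        (fun z z' => abs_nonneg _)).trans ?_
      have hlow := (neg_le_sumRootPairs_logb hR0 hR hF hτ₁ hfin (fun j => (hG j).1) hi)
      have hlow' := lower_bound_le_softBound N n₁ n₂ hn₂ hΛ hτ₁ hτ₂
      have hsum : sumRootPairs R F (fun z z' => |Real.logb 2 ‖evalInt₂ (G (i z z')) z z'‖|) =
          2 * sumRootPairs R F (fun z z' => logbPlus ‖evalInt₂ (G (i z z')) z z'‖) -
            sumRootPairs R F (fun z z' => Real.logb 2 ‖evalInt₂ (G (i z z')) z z'‖) := by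
        simp only [sumRootPairs, abs_logb_eq (norm_nonneg _), Multiset.sum_map_sub,
          Multiset.sum_map_mul_left]
      rw [hsum]
      unfold softBound at hup hlow' ⊢
      linarith
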